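/- Let $E$ be a real Banach space, $X\subseteq E$ a nonempty closed set and $Y$ a convex set in a real topological vector space. For $g:E\to\mathbb R$, $g$ is Gâteaux differentiable at $x$ if there is a continuous linear functional $g'(x)\in E^*$ with $\lim_{t\to0}\frac{g(x+tv)-g(x)}{t}=g'(x)(v)$ for all $v\in E$. If $\Phi,\Psi:E\to\mathbb R$ are Gâteaux differentiable at each point of $X$, the triple $(X,\Phi,\Psi)$ satisfies the *pointwise invariance condition* at $u_0\in X$ if there are $v_0\in X$ and a lower semicontinuous, convex functional $\gamma:E\to\mathbb R$, Gâteaux differentiable on $E$, such that either $$\Phi'(u_0)+\gamma'(u_0)=\Psi'(v_0)+\gamma'(v_0),$$ or $$\gamma'(0)=0\quad\text{and}\quad \Phi'(u_0)=\Psi'(v_0)+\gamma'(v_0-u_0).$$ A real function on a topological space is *inf-compact* if all its sublevel sets $\{f\le r\}$, $r\in\mathbb R$, are compact. **Theorem 1.2.** Let $I,J:E\times Y\to\mathbb R$ and $\alpha,\beta:E\to\mathbb R$. Assume that $\alpha$, $\beta$ and, for each $y\in Y$, $I(\cdot,y)$ and $J(\cdot,y)$ are Gâteaux differentiable at each point of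 $X$. Assume also that (suprema and infima being taken in $[-\infty,+\infty]$) $$\sup_{Y}\inf_{X}(I-J)<\inf_{X}\sup_{Y}(I-J)$$ and $$\sup_X(\alpha+\beta)-\inf_X(\alpha+\beta)<\inf_X\sup_Y(I-J)-\sup_Y\inf_X(I-J).$$ Moreover, suppose that: - $(i_1)$ for each $y\in Y$, the function $I(\cdot,y)+\alpha(\cdot)$ is lower semicontinuous and convex on $E$; - $(i_2)$ there exists a topology $\tau$ on $X$ such that, for each $y\in Y$, the function $I(\cdot,y)-J(\cdot,y)+\alpha(\cdot)+\beta(\cdot)$ is $\tau$-lower semicontinuous and $\tau$-inf-compact on $X$; - $(i_3)$ for each $x\in X$, the function $I(x,\cdot)-J(x,\cdot)$ is continuous and quasi-concave on $Y$; - $(i_4)$ for each $y\in Y$ and each $u\in X$ such that $I(u,y)-J(u,y)+\alpha(u)+\beta(u)=\inf_{x\in X}\bigl(I(x,y)-J(x,y)+\alpha(x)+\beta(x)\bigr)$, the triple $(X,\,J(\cdot,y)-\beta(\cdot),\,I(\cdot,y)+\alpha(\cdot))$ satisfies the pointwise invariance condition at $u$; - for each $y\in Y$, the function $J(\cdot,y)-\beta(\cdot)$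 is lower semicontinuous and convex on $E$. Then, for each convex set $S\subseteq Y$ dense in $Y$, there exists $\tilde y\in S$ such that the equation $$I'_x(x,\tilde y)-J'_x(x,\tilde y)+\alpha'(x)+\beta'(x)=0$$ has at least two distinct solutions $x\in X$, where $I'_x,J'_x$ denote the Gâteaux derivatives with respect to the first variable. -/

import Mathlib

section GateauxDerivatives

variable {E : Type*} [NormedAddCommGroup E] [NormedSpace ℝ E]

/-- `g'` is the Gâteaux derivative of `g : E → ℝ` at `x`: `g'` is a continuous linear functional and
`(g (x + t v) - g x) / t → g' v` as `t → 0`, for every direction `v`. -/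
def HasGateauxDerivAt (g : E → ℝ) (g' : E →L[ℝ] ℝ) (x : E) : Prop :=
  ∀ v : E, HasLineDerivAt ℝ g (g' v) x v

/-- `g` is Gâteaux differentiable at `x`. -/
def GateauxDifferentiableAt (g : E → ℝ) (x : E) : Prop :=
  ∃ g' : E →L[ℝ] ℝ, HasGateauxDerivAt g g' x

open Classical in
/-- The Gâteaux derivative of `g` at `x`, a continuous linear functional on `E`
(with the conventional value `0` when `g` is not Gâteaux differentiable at `x`). -/
noncomputable def gateauxDeriv (g : E → ℝ) (x : E) : E →L[ℝ] ℝ :=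
  if h : GateauxDifferentiableAt g x then h.choose else 0

theorem HasGateauxDerivAt.gateauxDeriv_eq {g : E → ℝ} {g' : E →L[ℝ] ℝ} {x : E}
    (h : HasGateauxDerivAt g g' x) : gateauxDeriv g x = g' := by
  have hd : GateauxDifferentiableAt g x := ⟨g', h⟩
  have hc : HasGateauxDerivAt g (gateauxDeriv g x) x := by
    rw [gateauxDeriv, dif_pos hd]
    exact hd.choose_spec
  ext v
  exact (hc v).lineDeriv.symm.trans (h v).lineDeriv

/-- The pointwise invariance condition of the triple `(X, Φ, Ψ)` at the point `u₀`: at least one of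
the two listed facts holds. It is meant for `u₀ ∈ X` and `Φ`, `Ψ` Gâteaux differentiable at each
point of `X`. -/
def PointwiseInvariantAt (X : Set E) (Φ Ψ : E → ℝ) (u₀ : E) : Prop :=
  (∃ v₀ ∈ X, ∃ γ : E → ℝ,
    LowerSemicontinuous γ ∧ ConvexOn ℝ Set.univ γ ∧ (∀ x, GateauxDifferentiableAt γ x) ∧
      gateauxDeriv Φ u₀ + gateauxDeriv γ u₀ = gateauxDeriv Ψ v₀ + gateauxDeriv γ v₀) ∨
  (∃ v₀ ∈ X, ∃ γ : E → ℝ,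
    LowerSemicontinuous γ ∧ ConvexOn ℝ Set.univ γ ∧ (∀ x, GateauxDifferentiableAt γ x) ∧
      gateauxDeriv γ 0 = 0 ∧
      gateauxDeriv Φ u₀ = gateauxDeriv Ψ v₀ + gateauxDeriv γ (v₀ - u₀))

end GateauxDerivatives

/-- A real function on a topological space is inf-compact if all its sublevel sets are compact. -/
def InfCompact {V : Type*} [TopologicalSpace V] (f : V → ℝ) : Prop :=
  ∀ r : ℝ, IsCompact {x : V | f x ≤ r}

/-- `sup_{y ∈ Y} inf_{x ∈ X} f(x, y)`, in the extended reals. -/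
noncomputable def supInf {E F : Type*} (X : Set E) (Y : Set F) (f : E → F → ℝ) : EReal :=
  ⨆ y ∈ Y, ⨅ x ∈ X, (f x y : EReal)

/-- `inf_{x ∈ X} sup_{y ∈ Y} f(x, y)`, in the extended reals. -/
noncomputable def infSup {E F : Type*} (X : Set E) (Y : Set F) (f : E → F → ℝ) : EReal :=
  ⨅ x ∈ X, ⨆ y ∈ Y, (f x y : EReal)

/-! Put `f = I - J + α + β` on `X × S`. Since `α + β` oscillates on `X` by less than the minimax gap
of `I - J`, some real level lies strictly above every `inf_X f(·, y)` and strictly below every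
`sup_S f(x, ·)`. If each `f(·, y)` had a unique minimizer on `X`, saddle points over polytopes
(`exists_saddle_convexHull`) and compactness of sublevel sets would give an `x` with `f(x, ·)` at
most that level on `S`. So some `f(·, y)` has two minimizers (`exists_two_minimizers`).

A minimizer on `X` need not be critical in `E`. Here `f(·, y) = Ψ - Φ` with `Φ`, `Ψ` convex, and the
invariance condition turns a minimizer over `X` into a global minimizer of an affine perturbation of
`Ψ + γ` (or of `Ψ` plus a translate of `γ`), which forces `Ψ' = Φ'` there
(`PointwiseInvariantAt.gateauxDeriv_eq`). -/

open Set Filter Topology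

/-! ### Inf-compact functions and their suprema over a compact parameter space. -/

section Minimax

variable {V : Type*} [TopologicalSpace V]

theorem InfCompact.exists_forall_le [Nonempty V] {f : V → ℝ} (hc : InfCompact f)
    (hf : LowerSemicontinuous f) : ∃ x, ∀ x', f x ≤ f x' := by
  obtain ⟨x₀⟩ := ‹Nonempty V›
  obtain ⟨x, -, hx⟩ := (hf.lowerSemicontinuousOn {x | f x ≤ f x₀}).exists_isMinOn
    ⟨x₀, le_refl (f x₀)⟩ (hc (f x₀))
  refine ⟨x, fun x' => ?_⟩
  rcases le_total (f x') (f x₀) with h | h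
  · exact hx h
  · exact (hx (le_refl (f x₀))).trans h

theorem LowerSemicontinuous.isClosed_sublevel {f : V → ℝ} (hf : LowerSemicontinuous f) (r : ℝ) :
    IsClosed {x | f x ≤ r} :=
  lowerSemicontinuous_iff_isClosed_preimage.1 hf r

section iSup

variable {K : Type*} [TopologicalSpace K] [CompactSpace K] {f : V → K → ℝ}

theorem bddAbove_range_of_continuous {h : K → ℝ} (hh : Continuous h) : BddAbove (range h) :=
  (isCompact_range hh).bddAbove

theorem lowerSemicontinuous_iSup_of_continuous [Nonempty K] (hf : ∀ x, Continuous (f x))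
    (hl : ∀ k, LowerSemicontinuous fun x => f x k) :
    LowerSemicontinuous fun x => ⨆ k, f x k :=
  lowerSemicontinuous_ciSup (fun x => bddAbove_range_of_continuous (hf x)) hl

theorem infCompact_iSup [Nonempty K] (hf : ∀ x, Continuous (f x))
    (hl : ∀ k, LowerSemicontinuous fun x => f x k) (hc : ∀ k, InfCompact fun x => f x k) :
    InfCompact fun x => ⨆ k, f x k := by
  intro r
  let k : K := Classical.arbitrary K
  refine (hc k r).of_isClosed_subset
    ((lowerSemicontinuous_iSup_of_continuous hf hl).isClosed_sublevel r) fun x hx => ?_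
  exact (le_ciSup (bddAbove_range_of_continuous (hf x)) k).trans hx

end iSup

/-! ### Minimax with a one-dimensional parameter. -/

section Interval

variable {g : V → ℝ → ℝ}

/-- If the minimizer `m t` of `g (·, t)` is unique, the set of `t` for which `g (m t, ·)` exceeds
the level `r` somewhere to the right of `t` is open. -/
theorem isOpen_setOf_exists_gt (hcont : ∀ x, Continuous (g x))
    (hconn : ∀ x r, OrdConnected {t | r < g x t})
    (hlsc : ∀ t, LowerSemicontinuous fun x => g x t) (hcpt : ∀ t, InfCompact fun x => g x t)
    {m : ℝ → V} (hm : ∀ t x, g (m t) t ≤ g x t)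
    (huniq : ∀ t x, (∀ x', g x t ≤ g x' t) → x = m t)
    {r : ℝ} (hr : ∀ t, g (m t) t < r) (hsup : ∀ x, ∃ t, r < g x t) :
    IsOpen {t | ∃ t' > t, r < g (m t) t'} := by
  rw [isOpen_iff_mem_nhds]
  intro t₀ ht₀
  by_contra hcon
  -- `L` describes `a → t₀` along points where `g (m a, ·)` exceeds `r` only at parameters `≤ a`.
  set L : Filter ℝ := 𝓝 t₀ ⊓ 𝓟 {t | ∃ t' > t, r < g (m t) t'}ᶜ with hL
  have hLne : L.NeBot := by
    rw [hL, ← frequently_mem_iff_neBot]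
    exact fun h => hcon (by filter_upwards [h] with t ht using not_not.1 ht)
  have key : ∀ t > t₀, ∀ s > g (m t₀) t₀, s ≤ r → ∀ᶠ a in L, g (m a) t ≤ s := by
    intro t ht s hs hsr
    have h1 : ∀ᶠ a in L, a < t := mem_inf_of_left (Iio_mem_nhds ht)
    have h2 : ∀ᶠ a in L, g (m t₀) a < s :=
      ((hcont (m t₀)).continuousAt.eventually_lt continuousAt_const hs).filter_mono inf_le_left
    have h3 : ∀ᶠ a in L, a ∈ {t | ∃ t' > t, r < g (m t) t'}ᶜ := mem_inf_of_right (mem_principal_self _)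
    filter_upwards [h1, h2, h3] with a ha1 ha2 ha3
    by_contra! hlt
    obtain ⟨b, hb⟩ := hsup (m a)
    have hba : b ≤ a := by
      by_contra! hab
      exact ha3 ⟨b, hab, hb⟩
    -- `a` lies between `b` and `t`, both in the superlevel set at `s`; but `m a` minimizes `g (·,
    -- a)`, and `g (m t₀, a) < s`.
    have : s < g (m a) a := (hconn (m a) s).out (hsr.trans_lt hb) hlt ⟨hba, ha1.le⟩
    linarith [hm a (m t₀)]
  obtain ⟨x, -, hx⟩ := (hcpt (t₀ + 1) r) (f := L.map m)
    (le_principal_iff.2 (key (t₀ + 1) (by simp) r (hr t₀) le_rfl))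
  have hle : ∀ t > t₀, ∀ s > g (m t₀) t₀, s ≤ r → g x t ≤ s := fun t ht s hs hsr =>
    ((hlsc t).isClosed_sublevel s).mem_of_mapClusterPt hx (key t ht s hs hsr)
  have hle' : ∀ t > t₀, g x t ≤ g (m t₀) t₀ := by
    intro t ht
    refine le_of_forall_gt_imp_ge_of_dense fun s hs => ?_
    exact (hle t ht _ (lt_min hs (hr t₀)) (min_le_right _ _)).trans (min_le_left _ _)
  have hle₀ : g x t₀ ≤ g (m t₀) t₀ :=
    le_of_tendsto ((hcont x).continuousAt.mono_left nhdsWithin_le_nhds)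
      (eventually_mem_nhdsWithin.mono fun t (ht : t ∈ Ioi t₀) => hle' t ht)
  -- The cluster point of the minimizers is `m t₀`, which by `hle'` stays below `r` to the right of
  -- `t₀`, against `ht₀`.
  obtain rfl := huniq t₀ x fun x' => hle₀.trans (hm t₀ x')
  obtain ⟨t, ht, hrt⟩ := ht₀
  linarith [hle' t ht, hr t₀]

/-- A minimax inequality on the interval `[0, 1]`, for functions with unique minimizers. -/
theorem exists_forall_le_of_unique_minimizer (hcont : ∀ x, Continuous (g x))
    (hconn : ∀ x r, OrdConnected {t | r < g x t})
    (hlsc : ∀ t, LowerSemicontinuous fun x => g x t) (hcpt : ∀ t, InfCompact fun x => g x t)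
    {m : ℝ → V} (hm : ∀ t x, g (m t) t ≤ g x t)
    (huniq : ∀ t x, (∀ x', g x t ≤ g x' t) → x = m t)
    {r : ℝ} (hr : ∀ t, g (m t) t < r) : ∃ x, ∀ t ∈ Icc (0 : ℝ) 1, g x t ≤ r := by
  by_contra! hcon
  have hsup : ∀ x, ∃ t, r < g x t := fun x => (hcon x).imp fun t ht => ht.2
  have hright := isOpen_setOf_exists_gt hcont hconn hlsc hcpt hm huniq hr hsup
  have hleft : IsOpen {t | ∃ t' < t, r < g (m t) t'} := by
    have := isOpen_setOf_exists_gt (g := fun x t => g x (-t)) (m := fun t => m (-t)) (r := r)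
      (fun x => (hcont x).comp continuous_neg)
      (fun x r => ⟨fun a ha b hb c hc =>
        (hconn x r).out hb ha ⟨neg_le_neg hc.2, neg_le_neg hc.1⟩⟩)
      (fun t => hlsc (-t)) (fun t => hcpt (-t)) (fun t => hm (-t)) (fun t => huniq (-t))
      (fun t => hr (-t)) (fun x => (hsup x).elim fun t ht => ⟨-t, by simpa using ht⟩)
    convert! this.preimage continuous_neg using 1
    ext t
    simp only [mem_ofPred_eq, mem_preimage, neg_neg]
    exact ⟨fun ⟨b, hb, h⟩ => ⟨-b, neg_lt_neg hb, by simpa using h⟩,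
      fun ⟨b, hb, h⟩ => ⟨-b, by linarith, h⟩⟩
  -- The two open sets cover the line and contain `0` and `1` respectively, so connectedness gives a
  -- common `t`; then `g (m t, ·) > r` on both sides of `t`, hence at `t`.
  obtain ⟨t, -, ⟨b, hb, hrb⟩, c, hc, hrc⟩ := isPreconnected_univ _ _ hright hleft
    (fun t _ => by
      obtain ⟨b, hb⟩ := hsup (m t)
      rcases lt_trichotomy t b with h | rfl | h
      · exact Or.inl ⟨b, h, hb⟩
      · exact absurd hb (hr t).not_gt
      · exact Or.inr ⟨b, h, hb⟩)
    (by
      obtain ⟨b, hb, hrb⟩ := hcon (m 0)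
      refine ⟨0, trivial, b, hb.1.lt_of_ne ?_, hrb⟩
      rintro rfl
      exact hrb.not_gt (hr 0))
    (by
      obtain ⟨b, hb, hrb⟩ := hcon (m 1)
      refine ⟨1, trivial, b, hb.2.lt_of_ne ?_, hrb⟩
      rintro rfl
      exact hrb.not_gt (hr 1))
  exact ((hconn (m t) r).out hrc hrb ⟨hc.le, hb.le⟩).not_gt (hr t)

/-- Take `t₀` maximizing the minimum and `x₀` minimizing the maximum; every `r` above the max-min is
also an upper bound for the min-max. `hproj` makes `g` constant in `t` beyond each endpoint, so
bounds on `[0, 1]` hold on the whole line. -/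
theorem exists_saddle_Icc [Nonempty V] (hcont : ∀ x, Continuous (g x))
    (hconn : ∀ x r, OrdConnected {t | r < g x t})
    (hlsc : ∀ t, LowerSemicontinuous fun x => g x t) (hcpt : ∀ t, InfCompact fun x => g x t)
    (huniq : ∀ t x x', (∀ z, g x t ≤ g z t) → (∀ z, g x' t ≤ g z t) → x = x')
    (hproj : ∀ x t, g x t = g x (projIcc (0 : ℝ) 1 zero_le_one t)) :
    ∃ t₀ ∈ Icc (0 : ℝ) 1, ∃ x₀, ∀ x, ∀ t ∈ Icc (0 : ℝ) 1, g x₀ t ≤ g x t₀ := by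
  choose m hm using fun t => (hcpt t).exists_forall_le (hlsc t)
  have husc : UpperSemicontinuousOn (fun t => g (m t) t) (Icc 0 1) := by
    intro t _ y hy
    filter_upwards [nhdsWithin_le_nhds
      ((hcont (m t)).continuousAt.eventually_lt continuousAt_const hy)] with a ha
    exact (hm a _).trans_lt ha
  obtain ⟨t₀, ht₀, hmax⟩ := husc.exists_isMaxOn ⟨0, by simp⟩ isCompact_Icc
  have hcont' : ∀ x, Continuous fun k : Icc (0 : ℝ) 1 => g x k :=
    fun x => (hcont x).comp continuous_subtype_val
  obtain ⟨x₀, hx₀⟩ := (infCompact_iSup hcont' (fun k => hlsc k) fun k => hcpt k).exists_forall_le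
    (lowerSemicontinuous_iSup_of_continuous hcont' fun k => hlsc k)
  refine ⟨t₀, ht₀, x₀, fun x t ht => (le_ciSup (bddAbove_range_of_continuous (hcont' x₀))
    ⟨t, ht⟩).trans (le_trans ?_ (hm t₀ x))⟩
  refine le_of_forall_gt_imp_ge_of_dense fun r hr => ?_
  obtain ⟨x₁, hx₁⟩ := exists_forall_le_of_unique_minimizer hcont hconn hlsc hcpt hm
    (fun t x h => huniq t x (m t) h (hm t)) (r := r) fun t => by
      refine lt_of_le_of_lt ?_ hr
      refine (hm t (m (projIcc (0 : ℝ) 1 zero_le_one t))).trans ?_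
      rw [hproj]
      exact hmax (projIcc (0 : ℝ) 1 zero_le_one t).2
  exact (hx₀ x₁).trans (ciSup_le fun k => hx₁ k k.2)

end Interval

end Minimax

/-! ### From the interval to polytopes and convex sets. -/

section MinimaxConvex

variable {V : Type*} [TopologicalSpace V] {F : Type*} [AddCommGroup F] [Module ℝ F]

/-- Slices of a cone with apex `y` combine convexly with their parameters, which makes the
superlevel sets of slicewise suprema intervals. If both weights vanish, the slice is the apex and
any `k` serves. -/
theorem exists_homothety_combo {Z : Set F} (hZ : Convex ℝ Z) (y : F) {k₁ k₂ : F} (h₁ : k₁ ∈ Z)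
    (h₂ : k₂ ∈ Z) {a b u v : ℝ} (ha : a ≤ 1) (hb : b ≤ 1) (hu : 0 ≤ u) (hv : 0 ≤ v)
    (huv : u + v = 1) :
    ∃ k ∈ Z, AffineMap.homothety y (1 - (u * a + v * b)) k =
      u • AffineMap.homothety y (1 - a) k₁ + v • AffineMap.homothety y (1 - b) k₂ := by
  have hua : 0 ≤ u * (1 - a) := mul_nonneg hu (by linarith)
  have hvb : 0 ≤ v * (1 - b) := mul_nonneg hv (by linarith)
  obtain rfl : v = 1 - u := by linarith
  set w : ℝ := u * (1 - a) + (1 - u) * (1 - b) with hw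
  have hw' : 1 - (u * a + (1 - u) * b) = w := by rw [hw]; ring
  simp only [hw', AffineMap.homothety_apply, vsub_eq_sub, vadd_eq_add]
  rcases (add_nonneg hua hvb).eq_or_lt with h0 | hpos
  · have e1 : u * (1 - a) = 0 := by linarith
    have e2 : (1 - u) * (1 - b) = 0 := by linarith
    refine ⟨k₁, h₁, ?_⟩
    rw [hw, ← h0, smul_add, smul_add, smul_smul, smul_smul, e1, e2]
    module
  · refine ⟨(u * (1 - a) / w) • k₁ + ((1 - u) * (1 - b) / w) • k₂,
      hZ h₁ h₂ (div_nonneg hua hpos.le) (div_nonneg hvb hpos.le) ?_, ?_⟩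
    · rw [← add_div]
      exact div_self hpos.ne'
    · rw [smul_sub, smul_add, smul_smul, smul_smul, mul_div_cancel₀ _ hpos.ne',
        mul_div_cancel₀ _ hpos.ne', hw]
      module

variable [TopologicalSpace F] [IsTopologicalAddGroup F] [ContinuousSMul ℝ F]

/-- A function that is continuous and quasi-concave in the second variable and has, at each point of
`S`, a unique minimizer in the first one, has a saddle point over each polytope in `S`. -/
theorem exists_saddle_convexHull [Nonempty V] {S : Set F} (hS : Convex ℝ S) {f : V → F → ℝ}
    (hcont : ∀ x, ContinuousOn (f x) S) (hquasi : ∀ x, QuasiconcaveOn ℝ S (f x))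
    (hlsc : ∀ y ∈ S, LowerSemicontinuous fun x => f x y)
    (hcpt : ∀ y ∈ S, InfCompact fun x => f x y)
    (huniq : ∀ y ∈ S, ∀ x x', (∀ z, f x y ≤ f z y) → (∀ z, f x' y ≤ f z y) → x = x')
    (n : ℕ) : ∀ s : Finset F, s.card ≤ n → s.Nonempty → (s : Set F) ⊆ S →
      ∃ z₀ ∈ convexHull ℝ (s : Set F), ∃ x₀, ∀ x, ∀ z ∈ convexHull ℝ (s : Set F),
        f x₀ z ≤ f x z₀ := by
  classical
  induction n with
  | zero =>
    intro s hs hne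
    exact absurd (Finset.card_eq_zero.1 (Nat.le_zero.1 hs)) hne.ne_empty
  | succ n ih =>
    intro s hs ⟨y, hy⟩ hsS
    have hyS : y ∈ S := hsS hy
    rcases (s.erase y).eq_empty_or_nonempty with he | hne
    · obtain ⟨x₀, hx₀⟩ := (hcpt y hyS).exists_forall_le (hlsc y hyS)
      have hsy : s = {y} := by rw [← Finset.insert_erase hy, he]; rfl
      subst hsy
      refine ⟨y, by simp, x₀, fun x z hz => ?_⟩
      obtain rfl : z = y := by simpa using hz
      exact hx₀ x
    set s' := s.erase y with hs'
    have hs'S : (s' : Set F) ⊆ S := fun z hz => hsS (Finset.mem_of_mem_erase hz)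
    set Z := convexHull ℝ (s' : Set F) with hZ
    have hZS : Z ⊆ S := convexHull_min hs'S hS
    have hsZ : convexHull ℝ (s : Set F) = convexJoin ℝ {y} Z := by
      rw [← Finset.insert_erase hy, Finset.coe_insert, convexHull_insert hne]
    have : CompactSpace Z := isCompact_iff_compactSpace.1 (s'.finite_toSet.isCompact_convexHull ℝ)
    have : Nonempty Z := (hne.to_set.mono (subset_convexHull ℝ _)).to_subtype
    -- Clamping extends the slice parameter to all of `ℝ`; `p t` maps the base `Z` onto the slice,
    -- with apex `y` at `t = 1`.
    let c : ℝ → ℝ := fun t => projIcc (0 : ℝ) 1 zero_le_one t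
    have hc : ∀ t, c t ∈ Icc (0 : ℝ) 1 := fun t => (projIcc (0 : ℝ) 1 zero_le_one t).2
    have hcc : Continuous c := continuous_subtype_val.comp continuous_projIcc
    have hc_of : ∀ t ∈ Icc (0 : ℝ) 1, c t = t := fun t ht => by
      simp only [c, projIcc_of_mem zero_le_one ht]
    let p : ℝ → F → F := fun t k => AffineMap.homothety y (1 - c t) k
    have hpl : ∀ t k, p t k = AffineMap.lineMap y k (1 - c t) := fun t k => rfl
    have hp_join : ∀ t, ∀ k : Z, p t k ∈ convexHull ℝ (s : Set F) := by
      intro t k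
      rw [hsZ, mem_convexJoin]
      refine ⟨y, rfl, k, k.2, ?_⟩
      rw [segment_eq_image_lineMap]
      exact ⟨1 - c t, ⟨by linarith [(hc t).2], by linarith [(hc t).1]⟩, rfl⟩
    have hpS : ∀ t, ∀ k : Z, p t k ∈ S := fun t k => convexHull_min hsS hS (hp_join t k)
    have hpc : Continuous fun q : ℝ × Z => p q.1 q.2 := by
      simp only [p, AffineMap.homothety_apply, vsub_eq_sub, vadd_eq_add]
      fun_prop
    have hfc : ∀ x, Continuous fun q : ℝ × Z => f x (p q.1 q.2) :=
      fun x => (hcont x).comp_continuous hpc fun q => hpS q.1 q.2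
    have hfc' : ∀ t x, Continuous fun k : Z => f x (p t k) :=
      fun t x => (hfc x).comp (by fun_prop : Continuous fun k : Z => (t, k))
    let g : V → ℝ → ℝ := fun x t => ⨆ k : Z, f x (p t k)
    have hle_g : ∀ x t (k : Z), f x (p t k) ≤ g x t :=
      fun x t k => le_ciSup (bddAbove_range_of_continuous (hfc' t x)) k
    -- Each slice is a polytope spanned by the images of the at most `n` vertices of `Z`, so the
    -- induction hypothesis applies.
    have hslice : ∀ t, ∃ k₀ : Z, ∃ x₀, ∀ x, ∀ k : Z, f x₀ (p t k) ≤ f x (p t k₀) := by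
      intro t
      have himg : convexHull ℝ ((s'.image (p t) : Finset F) : Set F) = p t '' Z := by
        rw [Finset.coe_image, hZ]
        exact (AffineMap.image_convexHull (AffineMap.homothety y (1 - c t)) _).symm
      obtain ⟨z₀, hz₀, x₀, hx₀⟩ := ih (s'.image (p t))
        (Finset.card_image_le.trans (by
          rw [hs', Finset.card_erase_of_mem hy]
          omega))
        (hne.image _) (by
          rw [Finset.coe_image]
          rintro _ ⟨k, hk, rfl⟩
          exact hpS t ⟨k, subset_convexHull ℝ _ hk⟩)
      rw [himg] at hz₀ hx₀
      obtain ⟨k₀, hk₀, rfl⟩ := hz₀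
      exact ⟨⟨k₀, hk₀⟩, x₀, fun x k => hx₀ x _ ⟨k, k.2, rfl⟩⟩
    obtain ⟨t₀, ht₀, x₀, hx₀⟩ := exists_saddle_Icc (g := g)
      (fun x => by
        have := isCompact_univ.continuous_sSup (f := fun t (k : Z) => f x (p t k)) (hfc x)
        simpa only [image_univ, sSup_range] using this)
      (fun x r => by
        refine ⟨fun a ha b hb d hd => ?_⟩
        have hlt : ∀ t, t ∈ {t | r < g x t} ↔ ∃ k : Z, r < f x (p t k) := fun t =>
          lt_ciSup_iff (bddAbove_range_of_continuous (hfc' t x))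
        rw [hlt] at ha hb ⊢
        obtain ⟨k₁, hk₁⟩ := ha
        obtain ⟨k₂, hk₂⟩ := hb
        have hmono : Monotone c := fun _ _ h => monotone_projIcc zero_le_one h
        obtain ⟨u, v, hu, hv, huv, hd'⟩ : c d ∈ segment ℝ (c a) (c b) := by
          rw [segment_eq_Icc (hmono (hd.1.trans hd.2))]
          exact ⟨hmono hd.1, hmono hd.2⟩
        obtain ⟨k, hk, hkp⟩ := exists_homothety_combo (convex_convexHull ℝ (s' : Set F)) y k₁.2 k₂.2
          (hc a).2 (hc b).2 hu hv huv
        refine ⟨⟨k, hk⟩, ?_⟩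
        have := (hquasi x).convex_gt r ⟨hpS a k₁, hk₁⟩ ⟨hpS b k₂, hk₂⟩ hu hv huv
        simp only [p, ← hd', smul_eq_mul, hkp]
        exact this.2)
      (fun t => lowerSemicontinuous_iSup_of_continuous (hfc' t) fun k => hlsc _ (hpS t k))
      (fun t => infCompact_iSup (hfc' t) (fun k => hlsc _ (hpS t k)) fun k => hcpt _ (hpS t k))
      (fun t => by
        obtain ⟨k₀, w, hw⟩ := hslice t
        -- By the saddle point on the slice, a minimizer of `g (·, t)` also minimizes `f (·, p t
        -- k₀)`, so uniqueness passes from `f` to `g`.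
        have hmin : ∀ x, (∀ z, g x t ≤ g z t) → x = w := fun x hx =>
          huniq _ (hpS t k₀) x w
            (fun z => (hle_g x t k₀).trans ((hx w).trans (ciSup_le fun k => hw z k)))
            (fun z => hw z k₀)
        exact fun x x' hx hx' => (hmin x hx).trans (hmin x' hx').symm)
      (fun x t => by simp only [g, p, c, projIcc_val])
    obtain ⟨k₀, w, hw⟩ := hslice t₀
    refine ⟨p t₀ k₀, hp_join t₀ k₀, x₀, fun x z hz => ?_⟩
    obtain ⟨t, ht, k, rfl⟩ : ∃ t ∈ Icc (0 : ℝ) 1, ∃ k : Z, p t k = z := by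
      rw [hsZ, mem_convexJoin] at hz
      obtain ⟨y', hy', k, hk, hz⟩ := hz
      obtain rfl : y' = y := hy'
      rw [segment_eq_image_lineMap] at hz
      obtain ⟨t, ht, rfl⟩ := hz
      have ht' : 1 - t ∈ Icc (0 : ℝ) 1 := ⟨by linarith [ht.2], by linarith [ht.1]⟩
      refine ⟨1 - t, ht', ⟨k, hk⟩, ?_⟩
      rw [hpl, hc_of _ ht', sub_sub_cancel]
    calc f x₀ (p t k) ≤ g x₀ t := hle_g x₀ t k
      _ ≤ g w t₀ := hx₀ w t ht
      _ ≤ f x (p t₀ k₀) := ciSup_le fun k => hw x k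

/-- Failure of the minimax equality forces two minimizers at some point of `S`. -/
theorem exists_two_minimizers {S : Set F} (hS : Convex ℝ S)
    (hSne : S.Nonempty) {f : V → F → ℝ}
    (hcont : ∀ x, ContinuousOn (f x) S) (hquasi : ∀ x, QuasiconcaveOn ℝ S (f x))
    (hlsc : ∀ y ∈ S, LowerSemicontinuous fun x => f x y)
    (hcpt : ∀ y ∈ S, InfCompact fun x => f x y) {r : ℝ}
    (hlt : ∀ y ∈ S, ∃ x, f x y < r) (hgt : ∀ x, ∃ y ∈ S, r < f x y) :
    ∃ y ∈ S, ∃ x x', x ≠ x' ∧ (∀ z, f x y ≤ f z y) ∧ ∀ z, f x' y ≤ f z y := by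
  classical
  by_contra! hcon
  have huniq : ∀ y ∈ S, ∀ x x', (∀ z, f x y ≤ f z y) → (∀ z, f x' y ≤ f z y) → x = x' := by
    intro y hy x x' hx hx'
    by_contra hne
    obtain ⟨z, hz⟩ := hcon y hy x x' hne hx
    exact hz.not_ge (hx' z)
  obtain ⟨y₀, hy₀⟩ := hSne
  have : Nonempty V := ⟨(hlt y₀ hy₀).choose⟩
  -- Finite intersection property in the compact sublevel set at `y₀`; a saddle point over the hull
  -- of finitely many `y` supplies a common point.
  obtain ⟨x, -, hx⟩ := (hcpt y₀ hy₀ r).inter_iInter_nonempty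
    (fun y : S => {x | f x y ≤ r}) (fun y => (hlsc y y.2).isClosed_sublevel r) (fun u => by
      set s : Finset F := insert y₀ (u.image Subtype.val) with hs
      have hsS : (s : Set F) ⊆ S := by
        intro z hz
        simp only [hs, Finset.coe_insert, Finset.coe_image, mem_insert_iff, mem_image] at hz
        rcases hz with rfl | ⟨w, -, rfl⟩
        exacts [hy₀, w.2]
      obtain ⟨z₀, hz₀, x₀, hx₀⟩ := exists_saddle_convexHull hS hcont hquasi hlsc hcpt huniq
        s.card s le_rfl (Finset.insert_nonempty _ _) hsS
      obtain ⟨x₁, hx₁⟩ := hlt z₀ (convexHull_min hsS hS hz₀)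
      have hle : ∀ z ∈ s, f x₀ z ≤ r := fun z hz =>
        (hx₀ x₁ z (subset_convexHull ℝ _ hz)).trans hx₁.le
      refine ⟨x₀, hle y₀ (Finset.mem_insert_self _ _), mem_iInter₂.2 fun y hy => ?_⟩
      exact hle y (Finset.mem_insert_of_mem (Finset.mem_image_of_mem _ hy)))
  obtain ⟨y, hy, hry⟩ := hgt x
  exact hry.not_ge (mem_iInter.1 hx ⟨y, hy⟩)

end MinimaxConvex

/-! ### Convexity, Gâteaux derivatives and the invariance condition. -/

section Invariance

variable {E : Type*} [NormedAddCommGroup E] [NormedSpace ℝ E] {f g : E → ℝ} {f' g' : E →L[ℝ] ℝ}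
  {u v : E}

theorem GateauxDifferentiableAt.hasGateauxDerivAt (h : GateauxDifferentiableAt f u) :
    HasGateauxDerivAt f (gateauxDeriv f u) u := by
  obtain ⟨f', hf⟩ := h
  rwa [hf.gateauxDeriv_eq]

theorem HasGateauxDerivAt.add (hf : HasGateauxDerivAt f f' u) (hg : HasGateauxDerivAt g g' u) :
    HasGateauxDerivAt (fun x => f x + g x) (f' + g') u :=
  fun w => HasDerivAt.add (hf w) (hg w)

theorem HasGateauxDerivAt.sub (hf : HasGateauxDerivAt f f' u) (hg : HasGateauxDerivAt g g' u) :
    HasGateauxDerivAt (fun x => f x - g x) (f' - g') u :=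
  fun w => HasDerivAt.sub (hf w) (hg w)

theorem HasGateauxDerivAt.comp_sub (hf : HasGateauxDerivAt f f' (v - u)) :
    HasGateauxDerivAt (fun x => f (x - u)) f' v := by
  intro w
  have h : HasDerivAt (fun t : ℝ => f (v - u + t • w)) (f' w) 0 := hf w
  show HasDerivAt (fun t : ℝ => f (v + t • w - u)) (f' w) 0
  simpa only [add_sub_right_comm] using h

theorem ConvexOn.add_gateauxDeriv_le (hc : ConvexOn ℝ univ f) (hf : HasGateauxDerivAt f f' u)
    (x : E) : f u + f' (x - u) ≤ f x := by
  have hd : HasDerivAt (fun t : ℝ => f (u + t • (x - u))) (f' (x - u)) 0 := hf (x - u)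
  have hφ : ConvexOn ℝ univ (fun t : ℝ => f (u + t • (x - u))) := by
    have := hc.comp_affineMap (AffineMap.lineMap u x : ℝ →ᵃ[ℝ] E)
    simpa [Function.comp_def, AffineMap.lineMap_apply, add_comm] using this
  have := hφ.le_slope_of_hasDerivAt (mem_univ 0) (mem_univ 1) one_pos hd
  simp [slope] at this
  rw [map_sub]
  linarith

theorem HasGateauxDerivAt.eq_zero_of_forall_le (hf : HasGateauxDerivAt f f' u)
    (hmin : ∀ x, f u ≤ f x) : f' = 0 := by
  ext w
  have hloc : IsLocalMin (fun t : ℝ => f (u + t • w)) 0 :=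
    Eventually.of_forall fun t => by simpa using hmin (u + t • w)
  exact hloc.hasDerivAt_eq_zero (hf w)

theorem ContinuousLinearMap.hasGateauxDerivAt (p : E →L[ℝ] ℝ) : HasGateauxDerivAt p p u :=
  fun w => p.hasFDerivAt.hasLineDerivAt w

/-- If the derivatives of the convex functions `f` at `u` and `g` at `v` agree and
`g - f` is not larger at `u` than at `v`, then `g` also has that derivative at `u`. -/
theorem HasGateauxDerivAt.eq_of_convexOn {p : E →L[ℝ] ℝ} (hfc : ConvexOn ℝ univ f)
    (hgc : ConvexOn ℝ univ g) (hf : HasGateauxDerivAt f p u) (hg : HasGateauxDerivAt g p v)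
    (hle : g u - f u ≤ g v - f v) (hgu : HasGateauxDerivAt g g' u) : g' = p := by
  have h1 := hfc.add_gateauxDeriv_le hf v
  have h2 : ∀ x, g v + p (x - v) ≤ g x := hgc.add_gateauxDeriv_le hg
  -- `g - p` is globally minimal at `v`, and `h1` with `hle` shows that its value at `u` is no
  -- larger.
  refine sub_eq_zero.1 ((hgu.sub p.hasGateauxDerivAt).eq_zero_of_forall_le fun x => ?_)
  have h3 := h2 x
  simp only [map_sub] at h1 h3 ⊢
  linarith

/-- Adding `γ` to both functions leaves `Ψ - Φ` unchanged. In the second alternative only `Ψ`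
receives `γ(· - u)`, which is harmless since `γ` is minimal at `0`, where `γ' = 0`. -/
theorem PointwiseInvariantAt.gateauxDeriv_eq {X : Set E} {Φ Ψ : E → ℝ}
    (h : PointwiseInvariantAt X Φ Ψ u) (hu : u ∈ X) (hΦ : GateauxDifferentiableAt Φ u)
    (hΨ : ∀ x ∈ X, GateauxDifferentiableAt Ψ x) (hΦc : ConvexOn ℝ univ Φ)
    (hΨc : ConvexOn ℝ univ Ψ) (hmin : ∀ x ∈ X, Ψ u - Φ u ≤ Ψ x - Φ x) :
    gateauxDeriv Ψ u = gateauxDeriv Φ u := by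
  rcases h with ⟨v, hv, γ, -, hγc, hγ, heq⟩ | ⟨v, hv, γ, -, hγc, hγ, hγ0, heq⟩
  · have := HasGateauxDerivAt.eq_of_convexOn (hΦc.add hγc) (hΨc.add hγc)
      (hΦ.hasGateauxDerivAt.add (hγ u).hasGateauxDerivAt)
      (heq ▸ (hΨ v hv).hasGateauxDerivAt.add (hγ v).hasGateauxDerivAt)
      (by simpa using hmin v hv) ((hΨ u hu).hasGateauxDerivAt.add (hγ u).hasGateauxDerivAt)
    exact add_right_cancel this
  · have hγu : HasGateauxDerivAt (fun x => γ (x - u)) (gateauxDeriv γ 0) u := by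
      refine HasGateauxDerivAt.comp_sub ?_
      rw [sub_self]
      exact (hγ 0).hasGateauxDerivAt
    have hγc' : ConvexOn ℝ univ fun x => γ (x - u) := by
      simpa [Function.comp_def, sub_eq_add_neg] using hγc.translate_left (-u)
    have hγle := hγc.add_gateauxDeriv_le (hγ 0).hasGateauxDerivAt (v - u)
    rw [hγ0] at hγle
    have := HasGateauxDerivAt.eq_of_convexOn hΦc (hΨc.add hγc') hΦ.hasGateauxDerivAt
      (heq ▸ (hΨ v hv).hasGateauxDerivAt.add (hγ (v - u)).hasGateauxDerivAt.comp_sub)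
      (by
        have := hmin v hv
        simp at hγle ⊢
        linarith) ((hΨ u hu).hasGateauxDerivAt.add hγu)
    rwa [hγ0, add_zero] at this

end Invariance

/-! ### The separating level and the conclusion. -/

/-- The bounds on the oscillation of `h` turn the gap between the two extended real numbers
`a` and `b` into a real level. -/
theorem EReal.exists_real_between_of_osc_lt {a b P Q : EReal} (hPQ : ⊥ < P) (hQ : Q < ⊤)
    (h : P - Q < b - a) :
    ∃ p q c : ℝ, P = p ∧ Q = q ∧ (c : EReal) < b ∧ a < ((c + q - p : ℝ) : EReal) := by
  have hP' : P ≠ ⊤ := by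
    rintro rfl
    rw [EReal.top_sub hQ.ne] at h
    exact not_top_lt h
  have hQ' : Q ≠ ⊥ := by
    rintro rfl
    rw [sub_eq_add_neg, EReal.neg_bot, EReal.add_top_of_ne_bot hPQ.ne'] at h
    exact not_top_lt h
  lift P to ℝ using ⟨hP', hPQ.ne'⟩
  lift Q to ℝ using ⟨hQ.ne, hQ'⟩
  have h' := EReal.add_lt_of_lt_sub h
  obtain ⟨c, hc₁, hc₂⟩ := EReal.lt_iff_exists_real_btwn.1 h'
  refine ⟨P, Q, c, rfl, rfl, hc₂, ?_⟩
  induction a with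
  | bot => exact EReal.bot_lt_coe _
  | top =>
    rw [← EReal.coe_sub, EReal.coe_add_top] at hc₁
    exact absurd hc₁ not_top_lt
  | coe a =>
    rw [← EReal.coe_sub, ← EReal.coe_add, EReal.coe_lt_coe_iff] at hc₁
    rw [EReal.coe_lt_coe_iff]
    linarith

theorem ContinuousOn.le_of_subset_closure {F : Type*} [TopologicalSpace F] {S Y : Set F}
    {h : F → ℝ} {r : ℝ} (hh : ContinuousOn h Y) (hSY : S ⊆ Y) (hY : Y ⊆ closure S)
    (hle : ∀ y ∈ S, h y ≤ r) : ∀ y ∈ Y, h y ≤ r := by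
  intro y hy
  have : (𝓝[S] y).NeBot := mem_closure_iff_nhdsWithin_neBot.1 (hY hy)
  exact le_of_tendsto ((hh y hy).mono_left (nhdsWithin_mono y hSY))
    (eventually_mem_nhdsWithin.mono hle)

theorem theorem1p2
    {E : Type*} [NormedAddCommGroup E] [NormedSpace ℝ E] [CompleteSpace E]
    {F : Type*} [AddCommGroup F] [Module ℝ F] [TopologicalSpace F]
    [IsTopologicalAddGroup F] [ContinuousSMul ℝ F]
    (X : Set E) (hXne : X.Nonempty) (hX : IsClosed X)
    (Y : Set F) (hY : Convex ℝ Y)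
    (I J : E → F → ℝ) (α β : E → ℝ)
    (hα : ∀ x ∈ X, GateauxDifferentiableAt α x)
    (hβ : ∀ x ∈ X, GateauxDifferentiableAt β x)
    (hI : ∀ y ∈ Y, ∀ x ∈ X, GateauxDifferentiableAt (fun z => I z y) x)
    (hJ : ∀ y ∈ Y, ∀ x ∈ X, GateauxDifferentiableAt (fun z => J z y) x)
    (hminimax : supInf X Y (fun x y => I x y - J x y) < infSup X Y (fun x y => I x y - J x y))
    -- none of the extended real differences below is of the form `∞ - ∞`, since `X` is nonempty
    -- and the previous inequality is strict
    (hosc : (⨆ x ∈ X, ((α x + β x : ℝ) : EReal)) - (⨅ x ∈ X, ((α x + β x : ℝ) : EReal)) <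
      infSup X Y (fun x y => I x y - J x y) - supInf X Y (fun x y => I x y - J x y))
    (i₁ : ∀ y ∈ Y, LowerSemicontinuous (fun x => I x y + α x) ∧
      ConvexOn ℝ Set.univ (fun x => I x y + α x))
    (i₂ : ∃ τ : TopologicalSpace X, ∀ y ∈ Y,
      @LowerSemicontinuous X ℝ τ _ (fun x : X => I x y - J x y + α x + β x) ∧
      @InfCompact X τ (fun x : X => I x y - J x y + α x + β x))
    (i₃ : ∀ x ∈ X, ContinuousOn (fun y => I x y - J x y) Y ∧
      QuasiconcaveOn ℝ Y (fun y => I x y - J x y))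
    (i₄ : ∀ y ∈ Y, ∀ u ∈ X, IsMinOn (fun x => I x y - J x y + α x + β x) X u →
      PointwiseInvariantAt X (fun x => J x y - β x) (fun x => I x y + α x) u)
    (hJβ : ∀ y ∈ Y, LowerSemicontinuous (fun x => J x y - β x) ∧
      ConvexOn ℝ Set.univ (fun x => J x y - β x)) :
    ∀ S : Set F, S ⊆ Y → Convex ℝ S → Y ⊆ closure S →
      ∃ y ∈ S, ∃ x₁ ∈ X, ∃ x₂ ∈ X, x₁ ≠ x₂ ∧
        gateauxDeriv (fun z => I z y) x₁ - gateauxDeriv (fun z => J z y) x₁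
          + gateauxDeriv α x₁ + gateauxDeriv β x₁ = 0 ∧
        gateauxDeriv (fun z => I z y) x₂ - gateauxDeriv (fun z => J z y) x₂
          + gateauxDeriv α x₂ + gateauxDeriv β x₂ = 0 := by
  intro S hSY hS hYS
  obtain ⟨x₀, hx₀⟩ := hXne
  obtain ⟨τ, hτ⟩ := i₂
  obtain ⟨p, q, c, hp, hq, hcb, hac⟩ := EReal.exists_real_between_of_osc_lt
    ((EReal.bot_lt_coe (α x₀ + β x₀)).trans_le
      (le_iSup₂ (f := fun x (_ : x ∈ X) => ((α x + β x : ℝ) : EReal)) x₀ hx₀))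
    ((iInf₂_le (f := fun x (_ : x ∈ X) => ((α x + β x : ℝ) : EReal)) x₀ hx₀).trans_lt
      (EReal.coe_lt_top (α x₀ + β x₀))) hosc
  have hp' : ∀ x ∈ X, α x + β x ≤ p := fun x hx => EReal.coe_le_coe_iff.1
    (hp ▸ le_iSup₂ (f := fun x (_ : x ∈ X) => ((α x + β x : ℝ) : EReal)) x hx)
  have hq' : ∀ x ∈ X, q ≤ α x + β x := fun x hx => EReal.coe_le_coe_iff.1
    (hq ▸ iInf₂_le (f := fun x (_ : x ∈ X) => ((α x + β x : ℝ) : EReal)) x hx)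
  -- The level is `c + q`: `α + β ≤ p` turns `I - J < c + q - p` into the upper bound, while `α + β
  -- ≥ q` and density of `S` turn `c < sup_Y (I - J)` into the lower one.
  have hlt : ∀ y ∈ S, ∃ x : X, I x y - J x y + α x + β x < c + q := by
    intro y hy
    have h := (le_iSup₂ (f := fun y (_ : y ∈ Y) => ⨅ x ∈ X, ((I x y - J x y : ℝ) : EReal))
      y (hSY hy)).trans_lt hac
    obtain ⟨x, hx, h⟩ := by simpa only [iInf_lt_iff] using h
    refine ⟨⟨x, hx⟩, ?_⟩
    have := EReal.coe_lt_coe_iff.1 h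
    dsimp only
    linarith [hp' x hx]
  have hgt : ∀ x : X, ∃ y ∈ S, c + q < I x y - J x y + α x + β x := by
    rintro ⟨x, hx⟩
    by_contra! hle
    have hle' := (i₃ x hx).1.le_of_subset_closure (r := c) hSY hYS fun y hy => by
      have := hle y hy
      dsimp only at this
      linarith [hq' x hx]
    refine hcb.not_ge ((iInf₂_le (f := fun x (_ : x ∈ X) =>
      ⨆ y ∈ Y, ((I x y - J x y : ℝ) : EReal)) x hx).trans ?_)
    exact iSup₂_le fun y hy => EReal.coe_le_coe_iff.2 (hle' y hy)
  have hcrit : ∀ y ∈ Y, ∀ u : X,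
      (∀ z : X, I u y - J u y + α u + β u ≤ I z y - J z y + α z + β z) →
      gateauxDeriv (fun z => I z y) u - gateauxDeriv (fun z => J z y) u
        + gateauxDeriv α u + gateauxDeriv β u = 0 := by
    rintro y hy ⟨u, hu⟩ hmin
    have hΦ := (hJ y hy u hu).hasGateauxDerivAt.sub (hβ u hu).hasGateauxDerivAt
    have hΨ : ∀ x ∈ X, HasGateauxDerivAt (fun x => I x y + α x) _ x := fun x hx =>
      (hI y hy x hx).hasGateauxDerivAt.add (hα x hx).hasGateauxDerivAt
    have h := (i₄ y hy u hu fun x hx => hmin ⟨x, hx⟩).gateauxDeriv_eq hu ⟨_, hΦ⟩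
      (fun x hx => ⟨_, hΨ x hx⟩) (hJβ y hy).2 (i₁ y hy).2 fun x hx => by
        have := hmin ⟨x, hx⟩
        dsimp only at this
        linarith
    rw [hΦ.gateauxDeriv_eq, (hΨ u hu).gateauxDeriv_eq, ← sub_eq_zero] at h
    rw [← h]
    abel
  obtain ⟨y, hy, ⟨x₁, hx₁⟩, ⟨x₂, hx₂⟩, hne, h₁, h₂⟩ := exists_two_minimizers (V := X) hS
    -- If `S` were empty, so would be `Y`, and the inf-sup would be `⊥`.
    (closure_nonempty_iff.1 (by
      by_contra hempty
      rw [not_nonempty_iff_eq_empty] at hempty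
      rw [hempty, subset_empty_iff] at hYS
      refine not_lt_bot (hcb.trans_le ((iInf₂_le (f := fun x (_ : x ∈ X) =>
        ⨆ y ∈ Y, ((I x y - J x y : ℝ) : EReal)) x₀ hx₀).trans ?_))
      simp [hYS]))
    (f := fun x y => I x y - J x y + α x + β x)
    (fun x => (((i₃ x x.2).1.mono hSY).add continuousOn_const).add continuousOn_const)
    (fun x r => by
      convert! hS.inter ((i₃ x x.2).2 (r - α x - β x)) using 1
      ext y
      simp only [mem_inter_iff, mem_ofPred_eq, sub_le_iff_le_add, add_right_comm _ (β _) (α _)]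
      exact ⟨fun h => ⟨h.1, hSY h.1, h.2⟩, fun h => ⟨h.1, h.2.2⟩⟩)
    (fun y hy => (hτ y (hSY hy)).1) (fun y hy => (hτ y (hSY hy)).2) hlt hgt
  exact ⟨y, hy, x₁, hx₁, x₂, hx₂, fun h => hne (Subtype.ext h), hcrit y (hSY hy) ⟨x₁, hx₁⟩ h₁,
    hcrit y (hSY hy) ⟨x₂, hx₂⟩ h₂⟩
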